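/- Let $A$ be a simple unital $C^*$-algebra. For positive $a,b\in A$ write $a\precsim b$ if there is a sequence $(x_n)$ in $A$ with $\lim_{n\to\infty}\|a-x_nbx_n^*\|=0$; write $[x,y]=xy-yx$. (1) Let $\alpha\colon G\to\mathrm{Aut}(A)$ be an action of a finite group $G$ with the *generalized tracial Rokhlin property*: for every $\varepsilon>0$, every finite set $F\subseteq A$ and every non-zero positive $a\in A$ there are positive elements $e_g\in A$ $(g\in G)$ of norm $1$ such that (i) $e_ge_h=0$ for $g\neq h$; (ii) $1-\sum_{g\in G}e_g\precsim a$; (iii) $\|[e_g,y]\|<\varepsilon$ for all $g\in G$, $y\in F$; (iv) $\|\alpha_g(e_h)-e_{gh}\|<\varepsilon$ for all $g,h\in G$. Then the crossed product $A\rtimes_\alpha G$ is simple. (2) Let $\alpha\in\mathrm{Aut}(A)$ be an automorphism with the *generalized tracial Rokhlin property*: for every finite set $F\subseteq A$, every $\varepsilon>0$, every integer $k\geq 1$ and every non-zero positive $a\in A$ there are positive elements $e_1,\dots,e_k\in A$ of norm $1$ such that (i) $e_ie_j=0$ for $i\neq j$; (ii) $1-\sum_{i=1}^k e_i\precsim a$;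 (iii) $\|[e_i,y]\|<\varepsilon$ for all $1\le i\le k$, $y\in F$; (iv) $\|\alpha(e_i)-e_{i+1}\|<\varepsilon$ for all $1\leq i\leq k-1$. Then the crossed product $A\rtimes_\alpha\mathbb{Z}$ by the action $n\mapsto\alpha^n$ is simple. Here a $C^*$-algebra is simple if it is non-zero and has no closed two-sided ideals other than $0$ and itself, and crossed products are full: the completion of the algebra of finite sums $\sum_g a_gu_g$ in the norm $\sup\|\sum_g\pi(a_g)U_g\|$ over all covariant representations $(\pi,U)$ on Hilbert spaces. -/

import Mathlib

open scoped ENNReal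

noncomputable section

/-- A `C⋆`-algebra is simple if it is nonzero and its only norm-closed two-sided ideals are the
zero ideal and the whole algebra. -/
def IsSimpleCStarAlgebra (A : Type*) [CStarAlgebra A] : Prop :=
  Nontrivial A ∧ ∀ I : TwoSidedIdeal A, IsClosed (I : Set A) → I = ⊥ ∨ I = ⊤

/-- Cuntz subequivalence `a ≾ b`: there is a sequence `x n` with `‖a - x n * b * (x n)⋆‖ → 0`.
It is only used for positive elements. -/
def CuntzSubequiv {A : Type*} [CStarAlgebra A] (a b : A) : Prop :=
  ∃ x : ℕ → A, Filter.Tendsto (fun n => ‖a - x n * b * star (x n)‖) Filter.atTop (nhds 0)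

/-- The generalized tracial Rokhlin property for an action of a finite group. -/
def FiniteGroupGTRP {A : Type*} [CStarAlgebra A] [PartialOrder A] [StarOrderedRing A]
    {G : Type*} [Group G] [Fintype G] (α : G →* (A ≃⋆ₐ[ℂ] A)) : Prop :=
  ∀ (ε : ℝ), 0 < ε → ∀ (F : Finset A) (a : A), 0 ≤ a → a ≠ 0 →
    ∃ e : G → A,
      (∀ g, 0 ≤ e g ∧ ‖e g‖ = 1) ∧
      (∀ g h, g ≠ h → e g * e h = 0) ∧
      CuntzSubequiv (1 - ∑ g, e g) a ∧
      (∀ g, ∀ y ∈ F, ‖e g * y - y * e g‖ < ε) ∧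
      (∀ g h, ‖α g (e h) - e (g * h)‖ < ε)

/-- The generalized tracial Rokhlin property for a single automorphism. The towers have positive
height `k` and are indexed by `Fin k`; nothing is required of the image of the top element. -/
def AutomorphismGTRP {A : Type*} [CStarAlgebra A] [PartialOrder A] [StarOrderedRing A]
    (α : A ≃⋆ₐ[ℂ] A) : Prop :=
  ∀ (F : Finset A) (ε : ℝ), 0 < ε → ∀ k : ℕ, 1 ≤ k → ∀ a : A, 0 ≤ a → a ≠ 0 →
    ∃ e : Fin k → A,
      (∀ i, 0 ≤ e i ∧ ‖e i‖ = 1) ∧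
      (∀ i j, i ≠ j → e i * e j = 0) ∧
      CuntzSubequiv (1 - ∑ i, e i) a ∧
      (∀ i, ∀ y ∈ F, ‖e i * y - y * e i‖ < ε) ∧
      (∀ i j : Fin k, (j : ℕ) = (i : ℕ) + 1 → ‖α (e i) - e j‖ < ε)

namespace CrossedProduct

universe u v

/-- A covariant representation of an action `α` of a discrete group `G` on a unital
`C⋆`-algebra `A`: a unital `⋆`-representation `π` of `A` and a unitary representation `U` of `G` on
a common nonzero Hilbert space with `U g * π a * (U g)⋆ = π (α g a)`. -/
structure CovariantRep {A : Type u} [CStarAlgebra A] {G : Type v} [Group G]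
    (α : G →* (A ≃⋆ₐ[ℂ] A)) : Type (max u v + 1) where
  H : Type (max u v)
  [normedAddCommGroup : NormedAddCommGroup H]
  [innerProductSpace : InnerProductSpace ℂ H]
  [completeSpace : CompleteSpace H]
  [nontrivial : Nontrivial H]
  π : A →⋆ₐ[ℂ] (H →L[ℂ] H)
  U : G →* unitary (H →L[ℂ] H)
  covariant : ∀ (g : G) (a : A),
    (U g : H →L[ℂ] H) * π a * star (U g : H →L[ℂ] H) = π (α g a)

attribute [instance] CovariantRep.normedAddCommGroup CovariantRep.innerProductSpace
  CovariantRep.completeSpace CovariantRep.nontrivial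

variable {A : Type u} [CStarAlgebra A] {G : Type v} [Group G] (α : G →* (A ≃⋆ₐ[ℂ] A))

/-- The `C⋆`-algebra of bounded families of operators, one on the Hilbert space of each covariant
representation, with the supremum norm. -/
abbrev Ambient : Type (max u v + 1) :=
  lp (fun ρ : CovariantRep α => ρ.H →L[ℂ] ρ.H) ∞

instance : CStarAlgebra (Ambient α) where

/-- The image of `A` under the universal covariant representation, `a ↦ (ρ.π a)_ρ`. -/
def ofAlgebra (a : A) : Ambient α :=
  ⟨fun ρ => ρ.π a, memℓp_infty ⟨‖a‖, by
    rintro _ ⟨ρ, rfl⟩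
    exact NonUnitalStarAlgHom.norm_apply_le ρ.π a⟩⟩

/-- The image of `G` under the universal covariant representation, `g ↦ (ρ.U g)_ρ`. -/
def ofGroup (g : G) : Ambient α :=
  ⟨fun ρ => (ρ.U g : ρ.H →L[ℂ] ρ.H), memℓp_infty ⟨1, by
    rintro _ ⟨ρ, rfl⟩
    exact (CStarRing.norm_of_mem_unitary (ρ.U g).2).le⟩⟩

/-- The full crossed product of `A` by `G`, as the `C⋆`-algebra generated by the images of `A` and
`G` in the universal covariant representation. Equivalently, it is the completion of the algebra of
finite sums `∑ a_g u_g` in the norm `sup ‖∑ π a_g * U g‖` over all covariant representations. -/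
def full : StarSubalgebra ℂ (Ambient α) :=
  (StarAlgebra.adjoin ℂ (Set.range (ofAlgebra α) ∪ Set.range (ofGroup α))).topologicalClosure

instance : CStarAlgebra (full α) :=
  StarSubalgebra.cstarAlgebra (full α)
    (h_closed := StarSubalgebra.isClosed_topologicalClosure _)

end CrossedProduct

end

/-! Let Φ be the canonical expectation of the crossed product onto A, and I a proper ideal.
Simplicity of A gives I ∩ A = 0, and Φ(I) is an ideal of A. If Φ(I) = A, some x ∈ I has Φ(x) = 1.
The Rokhlin condition supplies a positive e of norm 1, almost central and almost orthogonal to its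
translates, so e a u_g e ≈ a e α_g(e) u_g ≈ 0 for g ≠ 1 and e x e ≈ e². Thus e² is close to I, and
functional calculus produces a nonzero element of I ∩ A, a contradiction. Hence Φ(I) = 0
(`IsSimpleCStarAlgebra.of_expectation`).

That this forces I = 0 in the full crossed product is where amenability of G enters. In a covariant
representation (π, U), the averages |K|⁻¹ ∑_{m,n ∈ K} U_m Φ(u_m⁻¹ x u_n) U_n* are contractive in x
(`norm_sum_sum_compression_le`) and multiply a u_g by |K ∩ g⁻¹K| / |K|. Along Følner sets they tend
to x (`CovariantExpectation.tendsto_average`), so x = 0 once all Φ(u_m x u_n) vanish. The sets K are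
the whole group when G is finite, and intervals for ℤ. -/

noncomputable section

open scoped InnerProductSpace

/-! ### Operators on ℓ²(ι, H). -/

section HilbertSum

variable {ι H : Type*} [NormedAddCommGroup H] [InnerProductSpace ℂ H]

/-- The diagonal operator on `ℓ²(ι, H)` given by a bounded family of operators on `H`. -/
def diagonalOperator (T : ι → H →L[ℂ] H) (C : ℝ) (hT : ∀ i, ‖T i‖ ≤ C) :
    lp (fun _ : ι => H) 2 →L[ℂ] lp (fun _ : ι => H) 2 :=
  have hmem (x : lp (fun _ : ι => H) 2) (i : ι) : ‖T i (x i)‖ ≤ ‖((C : ℂ) • x) i‖ := by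
    rw [lp.coeFn_smul, Pi.smul_apply, norm_smul, Complex.norm_real]
    exact (T i).le_of_opNorm_le ((hT i).trans (Real.le_norm_self C)) _
  LinearMap.mkContinuous
    { toFun := fun x => ⟨fun i => T i (x i), (lp.memℓp ((C : ℂ) • x)).mono' (hmem x)⟩
      map_add' := fun x y => by ext i; exact map_add (T i) _ _
      map_smul' := fun c x => by ext i; exact map_smul (T i) _ _ } ‖C‖ fun x => by
    refine (lp.norm_mono (y := (C : ℂ) • x) two_ne_zero (hmem x)).trans_eq ?_
    rw [norm_smul, Complex.norm_real]

@[simp]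
theorem diagonalOperator_apply (T : ι → H →L[ℂ] H) (C : ℝ) (hT : ∀ i, ‖T i‖ ≤ C)
    (x : lp (fun _ : ι => H) 2) (i : ι) : diagonalOperator T C hT x i = T i (x i) :=
  rfl

/-- Permutation of the coordinates of `ℓ²(ι, H)`. -/
def permuteCoordinates (e : Equiv.Perm ι) :
    lp (fun _ : ι => H) 2 ≃ₗᵢ[ℂ] lp (fun _ : ι => H) 2 :=
  have hmem (e : Equiv.Perm ι) (x : lp (fun _ : ι => H) 2) : Memℓp (fun i => x (e i)) 2 := by
    have h := lp.memℓp x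
    rw [memℓp_gen_iff (by norm_num)] at h ⊢
    exact (e.summable_iff).2 h
  { toFun := fun x => ⟨fun i => x (e.symm i), hmem _ x⟩
    invFun := fun x => ⟨fun i => x (e i), hmem _ x⟩
    left_inv := fun x => by ext i; exact congrArg x (e.symm_apply_apply i)
    right_inv := fun x => by ext i; exact congrArg x (e.apply_symm_apply i)
    map_add' := fun x y => rfl
    map_smul' := fun c x => rfl
    norm_map' := fun x => by
      refine (sq_eq_sq₀ (norm_nonneg _) (norm_nonneg _)).1 ?_
      have h2 : (0 : ℝ) < (2 : ℝ≥0∞).toReal := by norm_num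
      have h (y : lp (fun _ : ι => H) 2) := lp.norm_rpow_eq_tsum h2 y
      simp only [ENNReal.toReal_ofNat, Real.rpow_ofNat] at h
      rw [h, h]
      exact e.symm.tsum_eq (fun i => ‖x i‖ ^ 2) }

section Representations

variable [CompleteSpace H]

/-- The direct sum on `ℓ²(ι, H)` of a family of representations on `H`. -/
def directSumRep {A : Type*} [CStarAlgebra A] (σ : ι → A →⋆ₐ[ℂ] (H →L[ℂ] H)) :
    A →⋆ₐ[ℂ] (lp (fun _ : ι => H) 2 →L[ℂ] lp (fun _ : ι => H) 2) where
  toFun a := diagonalOperator (fun i => σ i a) ‖a‖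
    fun i => NonUnitalStarAlgHom.norm_apply_le (σ i) a
  map_one' := by ext x i; simp
  map_mul' a b := by ext x i; simp
  map_zero' := by ext x i; simp
  map_add' a b := by ext x i; simp
  commutes' c := by ext x i; simp [Algebra.algebraMap_eq_smul_one]
  map_star' a := by
    refine (ContinuousLinearMap.eq_adjoint_iff _ _).2 fun x y => ?_
    simp only [lp.inner_eq_tsum, diagonalOperator_apply]
    refine tsum_congr fun i => ?_
    rw [map_star, ContinuousLinearMap.star_eq_adjoint, ContinuousLinearMap.adjoint_inner_left]

/-- A group acts on `ℓ²(G, H)` by left translation. -/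
def translationRep (G : Type*) [Group G] (H : Type*) [NormedAddCommGroup H]
    [InnerProductSpace ℂ H] [CompleteSpace H] :
    G →* unitary (lp (fun _ : G => H) 2 →L[ℂ] lp (fun _ : G => H) 2) :=
  Unitary.linearIsometryEquiv.symm.toMonoidHom.comp
    { toFun := fun g => permuteCoordinates (Equiv.mulLeft g)
      map_one' := by ext x i; exact congrArg x (show (1 : G)⁻¹ * i = i by simp)
      map_mul' := fun g h => by
        ext x i
        exact congrArg x (show (g * h)⁻¹ * i = h⁻¹ * (g⁻¹ * i) by group) }

@[simp]
theorem translationRep_apply {G : Type*} [Group G] (g : G) (x : lp (fun _ : G => H) 2) (i : G) :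
    (translationRep G H g : lp (fun _ : G => H) 2 →L[ℂ] lp (fun _ : G => H) 2) x i =
      x (g⁻¹ * i) :=
  rfl

end Representations

theorem norm_evalCLM_le (i : ι) : ‖lp.evalCLM ℂ (fun _ : ι => H) 2 i‖ ≤ 1 :=
  LinearMap.mkContinuous_norm_le _ zero_le_one _

variable [DecidableEq ι]

theorem norm_singleContinuousLinearMap_le (i : ι) :
    ‖lp.singleContinuousLinearMap ℂ (fun _ : ι => H) 2 i‖ ≤ 1 :=
  ContinuousLinearMap.opNorm_le_bound _ zero_le_one fun x => by simp

variable [CompleteSpace H]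

/-- Pythagoras: the vectors W_n* x are placed in mutually orthogonal coordinates, and each has norm
at most ‖x‖. -/
theorem norm_sum_single_comp_unitary_le [Nontrivial H] (W : ι → unitary (H →L[ℂ] H))
    (K : Finset ι) :
    ‖∑ n ∈ K, lp.singleContinuousLinearMap ℂ (fun _ : ι => H) 2 n ∘L
      star (W n : H →L[ℂ] H)‖ ≤ √(K.card) := by
  refine ContinuousLinearMap.opNorm_le_bound _ (Real.sqrt_nonneg _) fun x => ?_
  refine (sq_le_sq₀ (norm_nonneg _) (by positivity)).1 ?_
  have h := lp.norm_sum_single (p := 2) (by norm_num)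
    (fun n => star (W n : H →L[ℂ] H) x) K
  simp only [ENNReal.toReal_ofNat, Real.rpow_ofNat] at h
  simp only [_root_.sum_apply, ContinuousLinearMap.comp_apply,
    lp.singleContinuousLinearMap_apply]
  rw [h, mul_pow, Real.sq_sqrt (Nat.cast_nonneg _), ← nsmul_eq_mul]
  refine Finset.sum_le_card_nsmul _ _ _ fun n _ => ?_
  gcongr
  refine (ContinuousLinearMap.le_of_opNorm_le _ ?_ x).trans_eq (one_mul _)
  exact CStarRing.norm_of_mem_unitary (Unitary.star_mem (W n).2) |>.le

theorem adjoint_singleContinuousLinearMap (i : ι) :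
    (lp.singleContinuousLinearMap ℂ (fun _ : ι => H) 2 i).adjoint =
      lp.evalCLM ℂ (fun _ : ι => H) 2 i := by
  refine ((ContinuousLinearMap.eq_adjoint_iff (𝕜 := ℂ) _ _).2 fun x y => ?_).symm
  exact (lp.inner_single_right (𝕜 := ℂ) (G := fun _ : ι => H) i y x).symm

/-- The double sum equals S* y S, where S = ∑ i_n W_n* has norm at most √|K|. This gives |K| instead
of the trivial bound |K|². -/
theorem norm_sum_sum_compression_le [Nontrivial H] (W : ι → unitary (H →L[ℂ] H)) (K : Finset ι)
    (y : lp (fun _ : ι => H) 2 →L[ℂ] lp (fun _ : ι => H) 2) :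
    ‖∑ m ∈ K, ∑ n ∈ K, (W m : H →L[ℂ] H) ∘L (lp.evalCLM ℂ (fun _ : ι => H) 2 m ∘L y ∘L
      lp.singleContinuousLinearMap ℂ (fun _ : ι => H) 2 n) ∘L star (W n : H →L[ℂ] H)‖ ≤
      K.card * ‖y‖ := by
  set S := ∑ n ∈ K, lp.singleContinuousLinearMap ℂ (fun _ : ι => H) 2 n ∘L
      star (W n : H →L[ℂ] H) with hS
  have hS' : S.adjoint = ∑ m ∈ K, (W m : H →L[ℂ] H) ∘L lp.evalCLM ℂ (fun _ : ι => H) 2 m := by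
    rw [hS, map_sum]
    refine Finset.sum_congr rfl fun n _ => ?_
    rw [ContinuousLinearMap.adjoint_comp, adjoint_singleContinuousLinearMap,
      ← ContinuousLinearMap.star_eq_adjoint, star_star]
  have h : ∑ m ∈ K, ∑ n ∈ K, (W m : H →L[ℂ] H) ∘L (lp.evalCLM ℂ (fun _ : ι => H) 2 m ∘L y ∘L
      lp.singleContinuousLinearMap ℂ (fun _ : ι => H) 2 n) ∘L star (W n : H →L[ℂ] H) =
      S.adjoint ∘L y ∘L S := by
    rw [hS', hS]
    ext x
    simp only [_root_.sum_apply, ContinuousLinearMap.comp_apply, map_sum]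
    exact Finset.sum_comm
  have hn := norm_sum_single_comp_unitary_le (H := H) W K
  rw [h]
  calc ‖S.adjoint ∘L y ∘L S‖ ≤ ‖S.adjoint‖ * (‖y‖ * ‖S‖) :=
        (ContinuousLinearMap.opNorm_comp_le _ _).trans
          (mul_le_mul_of_nonneg_left (ContinuousLinearMap.opNorm_comp_le _ _) (norm_nonneg _))
    _ ≤ √(K.card) * (‖y‖ * √(K.card)) := by
        rw [LinearIsometryEquiv.norm_map]
        gcongr
    _ = K.card * ‖y‖ := by
        rw [mul_comm ‖y‖, ← mul_assoc, Real.mul_self_sqrt (Nat.cast_nonneg _)]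

end HilbertSum

/-! ### States and a nonzero representation, needed for covariant representations to exist. -/

section State

variable {A : Type*} [CStarAlgebra A] [PartialOrder A] [StarOrderedRing A]

open scoped ComplexOrder in
/-- Every nonzero unital `C⋆`-algebra has a state. -/
theorem exists_state [Nontrivial A] : ∃ f : A →ₚ[ℂ] ℂ, f 1 = 1 := by
  -- A functional with ‖f‖ = 1 = f(1), from Hahn–Banach, is automatically positive.
  obtain ⟨f, hf, hf1⟩ := exists_dual_vector ℂ (1 : A) (norm_ne_zero_iff.2 one_ne_zero)
  have hf1 : f 1 = 1 := by simpa using hf1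
  have hle (x : A) : ‖f x‖ ≤ ‖x‖ := by simpa [hf] using f.le_opNorm x
  have him (x : A) (hx : IsSelfAdjoint x) : (f x).im = 0 := by
    by_contra hne
    have key (t : ℝ) : ((f x).im + t) ^ 2 ≤ ‖x‖ ^ 2 + t ^ 2 := by
      have h1 : ‖x + (Complex.I * t) • (1 : A)‖ ^ 2 ≤ ‖x‖ ^ 2 + t ^ 2 := by
        rw [sq, ← CStarRing.norm_star_mul_self]
        have : star (x + (Complex.I * t) • (1 : A)) * (x + (Complex.I * t) • (1 : A)) =
            x * x + ((t : ℂ) ^ 2) • (1 : A) := by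
          simp only [star_add, hx.star_eq, star_smul, star_one, add_mul, mul_add, mul_smul_comm,
            smul_mul_assoc, mul_one, one_mul, smul_add, star_mul', Complex.star_def,
            Complex.conj_I, Complex.conj_ofReal]
          rw [smul_smul, show Complex.I * (t : ℂ) * (-Complex.I * t) = (t : ℂ) ^ 2 by
            linear_combination (-(t : ℂ) ^ 2) * Complex.I_mul_I, neg_mul, neg_smul]
          abel
        rw [this]
        refine (norm_add_le _ _).trans ?_
        gcongr
        · exact (norm_mul_le _ _).trans_eq (sq _).symm
        · simp [norm_smul]
      have h2 : ((f x).im + t) ^ 2 ≤ ‖f (x + (Complex.I * t) • (1 : A))‖ ^ 2 := by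
        have : (f (x + (Complex.I * t) • (1 : A))).im = (f x).im + t := by
          simp [hf1]
        rw [← this, ← sq_abs]
        gcongr
        exact Complex.abs_im_le_norm _
      exact h2.trans ((by gcongr; exact hle _ : _ ≤ _).trans h1)
    -- For this t the cross term 2t · Im f(x) is ‖x‖² + 1, which contradicts `key`.
    have := key ((‖x‖ ^ 2 + 1) / (2 * (f x).im))
    have h3 : 2 * (f x).im * ((‖x‖ ^ 2 + 1) / (2 * (f x).im)) = ‖x‖ ^ 2 + 1 := by
      field_simp
    nlinarith [sq_nonneg (f x).im]
  refine ⟨PositiveLinearMap.mk₀ (f : A →ₗ[ℂ] ℂ) fun x hx => ?_, hf1⟩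
  rw [Complex.nonneg_iff]
  refine ⟨?_, (him x (.of_nonneg hx)).symm⟩
  rcases eq_or_ne x 0 with rfl | hx0
  · simp
  have hpos : 0 < ‖x‖ := norm_pos_iff.2 hx0
  have hle1 : x ≤ algebraMap ℝ A ‖x‖ := IsSelfAdjoint.le_algebraMap_norm_self (.of_nonneg hx)
  -- Applying f gives |‖x‖ − f(x)| ≤ ‖x‖, hence Re f(x) ≥ 0.
  have hn : ‖algebraMap ℝ A ‖x‖ - x‖ ≤ ‖x‖ := by
    have := CStarAlgebra.norm_le_norm_of_nonneg_of_le (sub_nonneg.2 hle1)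
      (sub_le_self (algebraMap ℝ A ‖x‖) hx)
    simpa using this
  have h := (Complex.abs_re_le_norm _).trans ((hle _).trans hn)
  have h4 : f (algebraMap ℝ A ‖x‖ - x) = ‖x‖ - f x := by
    rw [map_sub, IsScalarTower.algebraMap_apply ℝ ℂ A, Algebra.algebraMap_eq_smul_one, map_smul,
      hf1]
    simp
  rw [h4] at h
  have := (abs_le.1 h).2
  simp at this
  simpa using this

open scoped ComplexOrder in
/-- Every nonzero unital `C⋆`-algebra has a nonzero GNS representation. -/
theorem exists_nontrivial_GNS [Nontrivial A] :
    ∃ f : A →ₚ[ℂ] ℂ, Nontrivial f.GNS := by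
  obtain ⟨f, hf⟩ := exists_state (A := A)
  refine ⟨f, ⟨(f.toPreGNS 1 : f.GNS), 0, fun h => ?_⟩⟩
  have := congrArg norm h
  rw [UniformSpace.Completion.norm_coe, norm_zero] at this
  have h2 := f.preGNS_norm_sq (f.toPreGNS 1)
  rw [this] at h2
  simp [hf] at h2

end State
end

noncomputable section

open Filter Topology

/-! ### Ideals and the abstract simplicity criterion. -/

section Ideals

variable {A : Type*} [CStarAlgebra A]

/-- A simple unital `C⋆`-algebra has no nontrivial ideals, closed or not. -/
theorem IsSimpleCStarAlgebra.eq_bot_or_eq_top (hA : IsSimpleCStarAlgebra A)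
    (J : TwoSidedIdeal A) : J = ⊥ ∨ J = ⊤ := by
  let Jc : TwoSidedIdeal A := TwoSidedIdeal.mk' (closure J)
    (subset_closure J.zero_mem)
    (fun hx hy => map_mem_closure₂ continuous_add hx hy fun _ ha _ hb => J.add_mem ha hb)
    (fun hx => map_mem_closure continuous_neg hx fun _ ha => J.neg_mem ha)
    (fun {x _} hy => map_mem_closure (continuous_const_mul x) hy fun _ ha => J.mul_mem_left _ _ ha)
    (fun {x y} hx => map_mem_closure (f := fun x => x * y) (continuous_mul_const y) hx
      fun _ ha => J.mul_mem_right _ _ ha)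
  have hJc : (Jc : Set A) = closure J := TwoSidedIdeal.coe_mk' _ _ _ _ _ _
  rcases hA.2 Jc (hJc ▸ isClosed_closure) with h | h
  · left
    rw [eq_bot_iff, ← h]
    intro x hx
    rw [← SetLike.mem_coe, hJc]
    exact subset_closure hx
  · right
    have h1 : (1 : A) ∈ closure (J : Set A) := by
      rw [← hJc, h]
      exact TwoSidedIdeal.mem_top A
    obtain ⟨a, haJ, ha⟩ := Metric.mem_closure_iff.1 h1 1 one_pos
    rw [dist_eq_norm] at ha
    obtain ⟨b, hb⟩ : ∃ b, a * b = 1 := by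
      refine ⟨↑(Units.oneSub (1 - a) ha)⁻¹, ?_⟩
      have := (Units.oneSub (1 - a) ha).mul_inv
      rwa [Units.val_oneSub, sub_sub_cancel] at this
    rw [← TwoSidedIdeal.one_mem_iff, ← hb]
    exact J.mul_mem_right _ _ haJ

/-- An ideal which comes close to the image of a positive element of norm `1` contains the image
of a nonzero element. -/
theorem exists_ne_zero_map_mem_of_norm_sub_lt [PartialOrder A] [StarOrderedRing A]
    {B : Type*} [CStarAlgebra B] (φ : A →⋆ₐ[ℂ] B) (I : TwoSidedIdeal B) {b : A} (hb : 0 ≤ b)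
    (hb1 : ‖b‖ = 1) {z : B} (hz : z ∈ I) (hzb : ‖φ b - z‖ < 1 / 2) :
    ∃ c : A, c ≠ 0 ∧ φ c ∈ I := by
  have : Nontrivial A := ⟨b, 0, by rintro rfl; simp at hb1⟩
  -- h is supported on t ≥ 1/2, where k(t) = 1/t, so h(t) · t · k(t) = h(t), while k ≤ 2 everywhere.
  let h : ℝ → ℝ := fun t => max (t - 1 / 2) 0
  let k : ℝ → ℝ := fun t => (max t (1 / 2))⁻¹
  have hpos (t : ℝ) : 0 < max t (1 / 2) := lt_max_of_lt_right (by norm_num)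
  have hh : Continuous h := by fun_prop
  have hk : Continuous k := Continuous.inv₀ (by fun_prop) fun t => (hpos t).ne'
  have hsa : IsSelfAdjoint b := .of_nonneg hb
  have hbk : cfc h b * b * cfc k b = cfc h b := by
    conv_lhs => rw [← cfc_id' ℝ b]
    rw [cfc_id' ℝ b]
    nth_rw 2 [← cfc_id' ℝ b]
    rw [← cfc_mul h (fun x => x) b hh.continuousOn, ← cfc_mul _ k b (by fun_prop) hk.continuousOn]
    refine cfc_congr fun t _ => ?_
    change max (t - 1 / 2) 0 * t * (max t (1 / 2))⁻¹ = max (t - 1 / 2) 0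
    rcases le_total t (1 / 2) with ht | ht
    · rw [max_eq_right (by linarith)]
      simp
    · rw [max_eq_left ht, mul_assoc, mul_inv_cancel₀ (by linarith), mul_one]
  have hk2 : ‖cfc k b‖ ≤ 2 := by
    refine norm_cfc_le zero_le_two fun t _ => ?_
    rw [Real.norm_eq_abs, abs_of_pos (inv_pos.2 (hpos t))]
    exact inv_le_of_inv_le₀ two_pos (by rw [inv_eq_one_div]; exact le_max_right _ _)
  have hlt : ‖(φ b - z) * φ (cfc k b)‖ < 1 := by
    have h1 : ‖φ (cfc k b)‖ ≤ 2 := (NonUnitalStarAlgHom.norm_apply_le φ _).trans hk2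
    calc _ ≤ ‖φ b - z‖ * ‖φ (cfc k b)‖ := norm_mul_le _ _
      _ ≤ ‖φ b - z‖ * 2 := by gcongr
      _ < 1 := by linarith
  -- w = 1 − (φ b − z) φ(k(b)) is invertible and φ(h(b)) w = φ(h(b)) z φ(k(b)) lies in I; hence so
  -- does φ(h(b)).
  let w := Units.oneSub _ hlt
  refine ⟨cfc h b, fun h0 => ?_, ?_⟩
  -- Since 1 is in the spectrum of b, h(1) = 1/2 is in that of h(b).
  · have h1 : (1 : ℝ) ∈ spectrum ℝ b := hb1 ▸ CStarAlgebra.norm_mem_spectrum_of_nonneg hb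
    have h2 : h 1 ∈ spectrum ℝ (cfc h b) := by
      rw [cfc_map_spectrum h b hsa hh.continuousOn]
      exact ⟨1, h1, rfl⟩
    rw [h0, spectrum.zero_eq, Set.mem_singleton_iff] at h2
    norm_num [h] at h2
  · have h1 : φ (cfc h b) * w = φ (cfc h b) * z * φ (cfc k b) := by
      have := congrArg φ hbk
      rw [map_mul, map_mul] at this
      rw [Units.val_oneSub, mul_sub, mul_one, sub_mul, mul_sub, ← mul_assoc, this, sub_sub_cancel,
        mul_assoc]
    have h2 : φ (cfc h b) = φ (cfc h b) * z * φ (cfc k b) * ↑w⁻¹ := by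
      rw [← h1, Units.mul_inv_cancel_right]
    rw [h2]
    exact I.mul_mem_right _ _ (I.mul_mem_right _ _ (I.mul_mem_left _ _ hz))

/-- A `C⋆`-algebra with a conditional expectation onto a simple subalgebra `A` is simple, if the
expectation is faithful on ideals and is approximately implemented by compression with positive
elements of norm one. -/
theorem IsSimpleCStarAlgebra.of_expectation [PartialOrder A] [StarOrderedRing A]
    (hA : IsSimpleCStarAlgebra A) {B : Type*} [CStarAlgebra B] [Nontrivial B] (φ : A →⋆ₐ[ℂ] B)
    (Φ : B →+ A) (hmul : ∀ a x b, Φ (φ a * x * φ b) = a * Φ x * b)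
    (hfaith : ∀ x, (∀ y z, Φ (y * x * z) = 0) → x = 0)
    (happrox : ∀ (x : B) (ε : ℝ), 0 < ε → ∃ e : A, 0 ≤ e ∧ ‖e‖ = 1 ∧
      ‖φ e * (x - φ (Φ x)) * φ e‖ < ε) :
    IsSimpleCStarAlgebra B := by
  refine ⟨inferInstance, fun I _ => ?_⟩
  rw [or_iff_not_imp_right]
  intro hI
  have hIA (c : A) (hc : φ c ∈ I) : c = 0 := by
    rcases hA.eq_bot_or_eq_top (I.comap φ) with h | h
    · rwa [← TwoSidedIdeal.mem_bot, ← h, TwoSidedIdeal.mem_comap]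
    · rw [← TwoSidedIdeal.one_mem_iff, TwoSidedIdeal.mem_comap, map_one,
        TwoSidedIdeal.one_mem_iff] at h
      exact absurd h hI
  -- Φ(I) need not be closed, so simplicity of A is applied in its form for arbitrary ideals.
  let J : TwoSidedIdeal A := TwoSidedIdeal.mk' {a | ∃ y ∈ I, Φ y = a}
    ⟨0, I.zero_mem, map_zero Φ⟩
    (by
      rintro a b ⟨x, hx, rfl⟩ ⟨y, hy, rfl⟩
      exact ⟨x + y, I.add_mem hx hy, map_add Φ x y⟩)
    (by
      rintro a ⟨x, hx, rfl⟩
      exact ⟨-x, I.neg_mem hx, map_neg Φ x⟩)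
    (by
      rintro a b ⟨x, hx, rfl⟩
      exact ⟨φ a * x * φ 1, I.mul_mem_right _ _ (I.mul_mem_left _ _ hx), by rw [hmul, mul_one]⟩)
    (by
      rintro a b ⟨x, hx, rfl⟩
      exact ⟨φ 1 * x * φ b, I.mul_mem_right _ _ (I.mul_mem_left _ _ hx), by rw [hmul, one_mul]⟩)
  have hJ (a : A) : a ∈ J ↔ ∃ y ∈ I, Φ y = a := TwoSidedIdeal.mem_mk' _ _ _ _ _ _ _
  have hJbot : J = ⊥ := by
    refine (hA.eq_bot_or_eq_top J).resolve_right fun htop => ?_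
    obtain ⟨x, hxI, hx⟩ := (hJ 1).1 (htop ▸ TwoSidedIdeal.mem_top A)
    obtain ⟨e, he, hnorm, hlt⟩ := happrox x (1 / 2) (by norm_num)
    have hsa : star e = e := (IsSelfAdjoint.of_nonneg he).star_eq
    have hpos : 0 ≤ e * e := by
      simpa [hsa] using star_mul_self_nonneg e
    have hone : ‖e * e‖ = 1 := by
      have := CStarRing.norm_star_mul_self (x := e)
      rwa [hsa, hnorm, one_mul] at this
    obtain ⟨c, hc0, hc⟩ := exists_ne_zero_map_mem_of_norm_sub_lt φ I hpos hone
      (z := φ e * x * φ e) (I.mul_mem_right _ _ (I.mul_mem_left _ _ hxI)) (by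
        rwa [hx, map_one, mul_sub, mul_one, sub_mul, ← map_mul, norm_sub_rev] at hlt)
    exact hc0 (hIA c hc)
  refine eq_bot_iff.2 fun x hx => (TwoSidedIdeal.mem_bot _).2 (hfaith x fun y z => ?_)
  rw [← TwoSidedIdeal.mem_bot, ← hJbot, hJ]
  exact ⟨_, I.mul_mem_right _ _ (I.mul_mem_left _ _ hx), rfl⟩

end Ideals

/-! ### Expectations on algebras generated by a covariant pair. -/

theorem norm_conj_le_of_norm_le_one {B : Type*} [NormedRing B] {a : B} (ha : ‖a‖ ≤ 1) (x : B) :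
    ‖a * x * a‖ ≤ ‖x‖ := by
  calc ‖a * x * a‖ ≤ ‖a‖ * ‖x‖ * ‖a‖ :=
        (norm_mul_le _ _).trans (by gcongr; exact norm_mul_le _ _)
    _ ≤ 1 * ‖x‖ * 1 := by gcongr
    _ = ‖x‖ := by ring

/-- For a uniformly bounded family of linear maps, the vectors along which it converges to zero
form a closed set. -/
theorem isClosed_setOf_tendsto_zero {E F τ : Type*} [NormedAddCommGroup E] [NormedSpace ℂ E]
    [NormedAddCommGroup F] [NormedSpace ℂ F] {l : Filter τ} (T : τ → E →ₗ[ℂ] F) {C : ℝ}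
    (hC : 0 ≤ C) (hT : ∀ i x, ‖T i x‖ ≤ C * ‖x‖) :
    IsClosed {x | Tendsto (fun i => T i x) l (𝓝 0)} := by
  refine isClosed_of_closure_subset fun x hx => ?_
  rw [Set.mem_ofPred_eq, NormedAddGroup.tendsto_nhds_zero]
  intro ε hε
  obtain ⟨y, hy, hxy⟩ := Metric.mem_closure_iff.1 hx (ε / 2 / (C + 1)) (by positivity)
  rw [Set.mem_ofPred_eq, NormedAddGroup.tendsto_nhds_zero] at hy
  filter_upwards [hy (ε / 2) (by positivity)] with i hi
  have h1 : ‖T i (x - y)‖ ≤ ε / 2 := by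
    rw [dist_eq_norm, lt_div_iff₀ (by positivity)] at hxy
    refine (hT i _).trans ?_
    nlinarith [norm_nonneg (x - y)]
  calc ‖T i x‖ = ‖T i (x - y) + T i y‖ := by rw [← map_add, sub_add_cancel]
    _ ≤ ‖T i (x - y)‖ + ‖T i y‖ := norm_add_le _ _
    _ < ε := by linarith


/-- Homomorphic images of `A` and `G` in a `C⋆`-algebra `B` which implement the action `α`, with a
contractive linear map on `B` that picks out the coefficient of `1`, such that its compressions
averaged over finite subsets of `G` are contractive as well. -/
structure CovariantExpectation {A G : Type*} [CStarAlgebra A] [Group G] [DecidableEq G]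
    (α : G →* (A ≃⋆ₐ[ℂ] A)) (B : Type*) [CStarAlgebra B] where
  /-- The image of `A`. -/
  ι : A →⋆ₐ[ℂ] B
  /-- The image of `G`. -/
  u : G →* B
  /-- The expectation. -/
  Φ : B →L[ℂ] B
  star_u : ∀ g, star (u g) = u g⁻¹
  norm_u_le : ∀ g, ‖u g‖ ≤ 1
  covariant : ∀ g a, u g * ι a = ι (α g a) * u g
  norm_Φ_le : ∀ x, ‖Φ x‖ ≤ ‖x‖
  Φ_mul_mul : ∀ a b x, Φ (ι a * x * ι b) = ι a * Φ x * ι b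
  Φ_monomial : ∀ a g, Φ (ι a * u g) = if g = 1 then ι a else 0
  norm_average_le : ∀ (K : Finset G) (x : B), ‖((K.card : ℂ)⁻¹) • ∑ m ∈ K, ∑ n ∈ K,
    u m * Φ (u m⁻¹ * x * u n) * u n⁻¹‖ ≤ ‖x‖

namespace CovariantExpectation

variable {A G B : Type*} [CStarAlgebra A] [Group G] [DecidableEq G] {α : G →* (A ≃⋆ₐ[ℂ] A)}
  [CStarAlgebra B] (E : CovariantExpectation α B)

/-- The elements `a u_g`. -/
def monomials : Set B :=
  Set.range fun p : A × G => E.ι p.1 * E.u p.2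

theorem monomials_mul_mem {x y : B} (hx : x ∈ E.monomials) (hy : y ∈ E.monomials) :
    x * y ∈ E.monomials := by
  obtain ⟨⟨a, g⟩, rfl⟩ := hx
  obtain ⟨⟨b, h⟩, rfl⟩ := hy
  refine ⟨(a * α g b, g * h), ?_⟩
  simp only [map_mul]
  rw [mul_assoc, ← mul_assoc _ (E.u g), ← E.covariant]
  simp only [mul_assoc]

theorem star_mem_monomials {x : B} (hx : x ∈ E.monomials) : star x ∈ E.monomials := by
  obtain ⟨⟨a, g⟩, rfl⟩ := hx
  refine ⟨(α g⁻¹ (star a), g⁻¹), ?_⟩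
  simp only [star_mul, E.star_u, ← map_star]
  rw [E.covariant]

/-- Covariance makes the monomials closed under products and adjoints, so their span is already a
star subalgebra. -/
theorem mem_span_monomials {x : B}
    (hx : x ∈ StarAlgebra.adjoin ℂ (Set.range E.ι ∪ Set.range E.u)) :
    x ∈ Submodule.span ℂ E.monomials := by
  induction hx using StarAlgebra.adjoin_induction with
  | mem x hx =>
    refine Submodule.subset_span ?_
    rcases hx with ⟨a, rfl⟩ | ⟨g, rfl⟩
    · exact ⟨(a, 1), by simp only [map_one, mul_one]⟩
    · exact ⟨(1, g), by simp only [map_one, one_mul]⟩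
  | algebraMap r =>
    refine Submodule.subset_span ⟨(algebraMap ℂ A r, 1), ?_⟩
    simp only [map_one, mul_one]
    exact AlgHomClass.commutes E.ι r
  | add x y _ _ hx hy => exact Submodule.add_mem _ hx hy
  | mul x y _ _ hx hy =>
    have h := Submodule.mul_mem_mul hx hy
    rw [Submodule.span_mul_span] at h
    refine Submodule.span_mono ?_ h
    rintro _ ⟨x, hx, y, hy, rfl⟩
    exact E.monomials_mul_mem hx hy
  | star x h hx =>
    clear h
    induction hx using Submodule.span_induction with
    | mem x hx => exact Submodule.subset_span (E.star_mem_monomials hx)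
    | zero => rw [star_zero]; exact Submodule.zero_mem _
    | add x y _ _ hx hy => rw [star_add]; exact Submodule.add_mem _ hx hy
    | smul c x _ hx => rw [star_smul]; exact Submodule.smul_mem _ _ hx

/-- The closed star subalgebra generated by the images of `A` and `G`. -/
def generated : StarSubalgebra ℂ B :=
  (StarAlgebra.adjoin ℂ (Set.range E.ι ∪ Set.range E.u)).topologicalClosure

theorem ι_mem_generated (a : A) : E.ι a ∈ E.generated :=
  StarSubalgebra.le_topologicalClosure _ (StarAlgebra.subset_adjoin ℂ _ (Or.inl ⟨a, rfl⟩))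

theorem u_mem_generated (g : G) : E.u g ∈ E.generated :=
  StarSubalgebra.le_topologicalClosure _ (StarAlgebra.subset_adjoin ℂ _ (Or.inr ⟨g, rfl⟩))

/-- A property of elements of `B` which holds for the `a u_g` and defines a closed subspace holds
on the generated subalgebra. -/
theorem generated_induction {p : B → Prop} (hmon : ∀ a g, p (E.ι a * E.u g))
    (hadd : ∀ x y, p x → p y → p (x + y)) (hsmul : ∀ (c : ℂ) x, p x → p (c • x))
    (hclosed : IsClosed {x | p x}) {x : B} (hx : x ∈ E.generated) : p x := by
  refine hclosed.closure_subset_iff.2 (fun y hy => ?_) hx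
  replace hy := E.mem_span_monomials hy
  induction hy using Submodule.span_induction with
  | mem y hy => obtain ⟨⟨a, g⟩, rfl⟩ := hy; exact hmon a g
  | zero => simpa using hsmul 0 _ (hmon 0 1)
  | add x y _ _ hx hy => exact hadd x y hx hy
  | smul c x _ hx => exact hsmul c x hx

/-- The compressions averaged over a finite set. -/
def average (K : Finset G) : B →ₗ[ℂ] B where
  toFun x := ((K.card : ℂ)⁻¹) • ∑ m ∈ K, ∑ n ∈ K,
    E.u m * E.Φ (E.u m⁻¹ * x * E.u n) * E.u n⁻¹
  map_add' x y := by
    simp only [mul_add, add_mul, map_add, Finset.sum_add_distrib, smul_add]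
  map_smul' c x := by
    simp only [mul_smul_comm, smul_mul_assoc, map_smul, ← Finset.smul_sum, RingHom.id_apply]
    rw [smul_comm]

theorem average_apply (K : Finset G) (x : B) :
    E.average K x = ((K.card : ℂ)⁻¹) • ∑ m ∈ K, ∑ n ∈ K,
      E.u m * E.Φ (E.u m⁻¹ * x * E.u n) * E.u n⁻¹ :=
  rfl

theorem norm_ι_le (a : A) : ‖E.ι a‖ ≤ ‖a‖ :=
  NonUnitalStarAlgHom.norm_apply_le _ a

/-- The (m, n) term is nonzero only for m = g n, when it returns a u_g; what remains is to count the
n ∈ K with g n ∈ K. -/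
theorem average_monomial (K : Finset G) (a : A) (g : G) :
    E.average K (E.ι a * E.u g) =
      ((({n ∈ K | g * n ∈ K}).card : ℂ) / K.card) • (E.ι a * E.u g) := by
  have h (m n : G) : E.u m * E.Φ (E.u m⁻¹ *
      (E.ι a * E.u g) * E.u n) * E.u n⁻¹ =
      if m = g * n then E.ι a * E.u g else 0 := by
    rw [← mul_assoc, E.covariant, mul_assoc (E.ι (α m⁻¹ a)),
      mul_assoc (E.ι (α m⁻¹ a)), ← map_mul, ← map_mul, E.Φ_monomial]
    have hiff : m⁻¹ * g * n = 1 ↔ m = g * n := by rw [mul_assoc, inv_mul_eq_one]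
    simp only [hiff]
    split_ifs with hm
    · rw [E.covariant, mul_assoc, ← map_mul, ← StarAlgEquiv.mul_apply,
        ← map_mul, mul_inv_cancel, map_one, hm, mul_inv_cancel_right]
      rfl
    · simp
  rw [E.average_apply, Finset.sum_comm]
  simp only [h, Finset.sum_ite_eq', ← Finset.sum_filter, Finset.sum_const]
  rw [← Nat.cast_smul_eq_nsmul ℂ, smul_smul, div_eq_inv_mul]

theorem tendsto_zero_of_mem_generated {τ : Type*} {l : Filter τ}
    (T : τ → B →ₗ[ℂ] B) {C : ℝ} (hC : 0 ≤ C) (hT : ∀ i x, ‖T i x‖ ≤ C * ‖x‖)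
    (hmon : ∀ a g, Tendsto (fun i => T i (E.ι a * E.u g)) l (𝓝 0))
    {x : B} (hx : x ∈ E.generated) : Tendsto (fun i => T i x) l (𝓝 0) := by
  refine E.generated_induction (p := fun x => Tendsto (fun i => T i x) l (𝓝 0)) hmon ?_ ?_
    (isClosed_setOf_tendsto_zero T hC hT) hx
  · intro x y hx hy
    simpa only [map_add, add_zero] using hx.add hy
  · intro c x hx
    simpa only [map_smul, smul_zero] using hx.const_smul c

/-- Along a Følner net the averaged compressions converge to the identity on the generated
subalgebra. -/
theorem tendsto_average {κ : Type*} {k : Filter κ} {K : κ → Finset G}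
    (hK : ∀ g, Tendsto (fun i => (({n ∈ K i | g * n ∈ K i}).card : ℂ) / (K i).card) k (𝓝 1))
    {x : B} (hx : x ∈ E.generated) :
    Tendsto (fun i => E.average (K i) x) k (𝓝 x) := by
  rw [← tendsto_sub_nhds_zero_iff]
  refine E.tendsto_zero_of_mem_generated (fun i => E.average (K i) - LinearMap.id)
    zero_le_two (fun i x => ?_) (fun a g => ?_) hx
  · rw [LinearMap.sub_apply, LinearMap.id_apply, two_mul]
    exact (norm_sub_le _ _).trans (by gcongr; exact E.norm_average_le _ _)
  · simp only [LinearMap.sub_apply, LinearMap.id_apply, E.average_monomial]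
    rw [tendsto_sub_nhds_zero_iff]
    simpa using (hK g).smul_const (E.ι a * E.u g)

/-- If the group has a Følner net, an element with vanishing coefficients is zero. -/
theorem eq_zero_of_Φ_eq_zero {κ : Type*} {k : Filter κ} [k.NeBot] {K : κ → Finset G}
    (hK : ∀ g, Tendsto (fun i => (({n ∈ K i | g * n ∈ K i}).card : ℂ) / (K i).card) k (𝓝 1))
    {x : B} (hx : x ∈ E.generated)
    (h : ∀ m n, E.Φ (E.u m * x * E.u n) = 0) : x = 0 := by
  refine tendsto_nhds_unique (E.tendsto_average hK hx) ?_
  simp [E.average_apply, h]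

/-- The difference of `x` and its conditional expectation, multiplied by `b` on both sides. -/
def conjSub (b : B) : B →ₗ[ℂ] B where
  toFun x := b * (x - E.Φ x) * b
  map_add' x y := by rw [map_add, add_sub_add_comm, mul_add, add_mul]
  map_smul' c x := by rw [map_smul, ← smul_sub, mul_smul_comm, smul_mul_assoc, RingHom.id_apply]

theorem conjSub_apply (b x : B) :
    E.conjSub b x = b * (x - E.Φ x) * b :=
  rfl

theorem norm_conjSub_le {b : B} (hb : ‖b‖ ≤ 1) (x : B) :
    ‖E.conjSub b x‖ ≤ 2 * ‖x‖ := by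
  refine (norm_conj_le_of_norm_le_one hb (x - E.Φ x)).trans ?_
  rw [two_mul]
  exact (norm_sub_le _ _).trans (by gcongr; exact E.norm_Φ_le x)

/-- For g ≠ 1 the expectation of a u_g vanishes, and e a u_g e = e a α_g(e) u_g. Commuting e past a
isolates e α_g(e). -/
theorem norm_conjSub_monomial_le (e a : A) {g : G} (hg : g ≠ 1) :
    ‖E.conjSub (E.ι e) (E.ι a * E.u g)‖ ≤
      ‖(e * a - a * e) * α g e + a * (e * α g e)‖ := by
  have h : E.conjSub (E.ι e) (E.ι a * E.u g) =
      E.ι ((e * a - a * e) * α g e + a * (e * α g e)) * E.u g := by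
    rw [E.conjSub_apply, E.Φ_monomial, if_neg hg, sub_zero, mul_assoc,
      mul_assoc _ (E.u g), E.covariant, ← mul_assoc, ← mul_assoc,
      ← map_mul, ← map_mul, sub_mul, ← mul_assoc a, sub_add_cancel]
  rw [h]
  refine (norm_mul_le _ _).trans ?_
  refine (mul_le_of_le_one_right (norm_nonneg _) (E.norm_u_le g)).trans ?_
  exact E.norm_ι_le _

/-- Approximately central elements which are approximately orthogonal to their translates
implement the conditional expectation. -/
theorem tendsto_conjSub {τ : Type*} {l : Filter τ} {e : τ → A}
    (hnorm : ∀ i, ‖e i‖ ≤ 1) (hcomm : ∀ y, Tendsto (fun i => e i * y - y * e i) l (𝓝 0))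
    (horth : ∀ g, g ≠ 1 → Tendsto (fun i => e i * α g (e i)) l (𝓝 0))
    {x : B} (hx : x ∈ E.generated) :
    Tendsto (fun i => E.conjSub (E.ι (e i)) x) l (𝓝 0) := by
  refine E.tendsto_zero_of_mem_generated (fun i => E.conjSub (E.ι (e i)))
    zero_le_two (fun i x => E.norm_conjSub_le
      ((E.norm_ι_le _).trans (hnorm i)) x) (fun a g => ?_) hx
  rcases eq_or_ne g 1 with rfl | hg
  · have h (i : τ) : E.conjSub (E.ι (e i))
        (E.ι a * E.u 1) = 0 := by
      rw [E.conjSub_apply, E.Φ_monomial, if_pos rfl, map_one, mul_one, sub_self,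
        mul_zero, zero_mul]
    simp only [h]
    exact tendsto_const_nhds
  · have h1 : Tendsto (fun i => (e i * a - a * e i) * α g (e i)) l (𝓝 0) := by
      refine squeeze_zero_norm (fun i => ?_) (tendsto_zero_iff_norm_tendsto_zero.1 (hcomm a))
      refine (norm_mul_le _ _).trans (mul_le_of_le_one_right (norm_nonneg _) ?_)
      exact (StarAlgEquiv.norm_map (α g) (e i)).trans_le (hnorm i)
    have h2 : Tendsto (fun i => (e i * a - a * e i) * α g (e i) + a * (e i * α g (e i))) l
        (𝓝 0) := by
      simpa using h1.add ((horth g hg).const_mul a)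
    exact squeeze_zero_norm (fun i => E.norm_conjSub_monomial_le (e i) a hg)
      (tendsto_zero_iff_norm_tendsto_zero.1 h2)

theorem ι_injective (hA : IsSimpleCStarAlgebra A) [Nontrivial B] :
    Function.Injective (E.ι) := by
  rcases hA.eq_bot_or_eq_top (TwoSidedIdeal.ker (E.ι)) with h | h
  · refine (injective_iff_map_eq_zero _).2 fun a ha => ?_
    rwa [← TwoSidedIdeal.mem_bot, ← h, TwoSidedIdeal.mem_ker]
  · rw [← TwoSidedIdeal.one_mem_iff, TwoSidedIdeal.mem_ker, map_one] at h
    exact absurd h one_ne_zero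

/-- Φ takes values in B; that it lands in A holds on monomials and passes to limits, because the
injective ι is isometric and so has closed range. -/
theorem Φ_mem_range (hA : IsSimpleCStarAlgebra A) [Nontrivial B]
    {x : B} (hx : x ∈ E.generated) : ∃ a, E.Φ x = E.ι a := by
  have hcl : IsClosed (Set.range (E.ι)) :=
    (NonUnitalStarAlgHom.isometry _ (E.ι_injective hA)).isClosedEmbedding.isClosed_range
  refine E.generated_induction (p := fun x => ∃ a, E.Φ x = E.ι a) ?_ ?_ ?_ ?_ hx
  · intro a g
    rw [E.Φ_monomial]
    split_ifs
    · exact ⟨a, rfl⟩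
    · exact ⟨0, (map_zero _).symm⟩
  · rintro x y ⟨a, ha⟩ ⟨b, hb⟩
    exact ⟨a + b, by rw [map_add, map_add, ha, hb]⟩
  · rintro c x ⟨a, ha⟩
    exact ⟨c • a, by rw [map_smul, map_smul, ha]⟩
  · convert! hcl.preimage E.Φ.continuous using 1
    ext x
    exact ⟨fun ⟨a, ha⟩ => ⟨a, ha.symm⟩, fun ⟨a, ha⟩ => ⟨a, ha.symm⟩⟩

/-- If `A` is simple, the group has a Følner net and `A` has positive elements of norm one which are
approximately central and approximately orthogonal to their translates, then the generated
subalgebra is simple. -/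
theorem isSimple_generated [Nontrivial B] [PartialOrder A] [StarOrderedRing A]
    (hA : IsSimpleCStarAlgebra A)
    {κ : Type*} {k : Filter κ} [k.NeBot] {K : κ → Finset G}
    (hK : ∀ g, Tendsto (fun i => (({n ∈ K i | g * n ∈ K i}).card : ℂ) / (K i).card) k (𝓝 1))
    {τ : Type*} {l : Filter τ} [l.NeBot] {e : τ → A} (he : ∀ i, 0 ≤ e i) (hnorm : ∀ i, ‖e i‖ = 1)
    (hcomm : ∀ y, Tendsto (fun i => e i * y - y * e i) l (𝓝 0))
    (horth : ∀ g, g ≠ 1 → Tendsto (fun i => e i * α g (e i)) l (𝓝 0)) :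
    @IsSimpleCStarAlgebra E.generated (StarSubalgebra.cstarAlgebra E.generated
      (h_closed := StarSubalgebra.isClosed_topologicalClosure _)) := by
  let _ : CStarAlgebra E.generated := StarSubalgebra.cstarAlgebra E.generated
      (h_closed := StarSubalgebra.isClosed_topologicalClosure _)
  have hinj := E.ι_injective hA
  have : Nontrivial E.generated :=
    ⟨1, 0, fun h => one_ne_zero (congrArg (Subtype.val : E.generated → B) h)⟩
  choose Ψ hΨ using fun x : E.generated => E.Φ_mem_range hA x.2
  refine hA.of_expectation (StarAlgHom.codRestrict E.ι E.generated E.ι_mem_generated)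
    (AddMonoidHom.mk' Ψ fun x y => hinj ?_) (fun a x b => hinj ?_) (fun x hx => ?_)
    fun x ε hε => ?_
  · rw [← hΨ, map_add, ← hΨ, ← hΨ, ← map_add]
    rfl
  · change E.ι (Ψ _) = E.ι (a * Ψ x * b)
    rw [← hΨ, map_mul, map_mul, ← hΨ]
    exact E.Φ_mul_mul a b x
  · refine Subtype.ext (E.eq_zero_of_Φ_eq_zero hK x.2 fun m n => ?_)
    have h := hx ⟨E.u m, E.u_mem_generated m⟩ ⟨E.u n, E.u_mem_generated n⟩
    change Ψ _ = 0 at h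
    have h2 := hΨ (⟨E.u m, E.u_mem_generated m⟩ * x * ⟨E.u n, E.u_mem_generated n⟩)
    rw [h, map_zero] at h2
    exact h2
  · have hlim := E.tendsto_conjSub (fun i => (hnorm i).le) hcomm horth x.2
    obtain ⟨i, hi⟩ := (NormedAddGroup.tendsto_nhds_zero.1 hlim ε hε).exists
    refine ⟨e i, he i, hnorm i, ?_⟩
    rw [E.conjSub_apply, hΨ] at hi
    exact hi

end CovariantExpectation
end

noncomputable section

open Filter Topology

/-! ### Regular representations and the universal covariant pair. -/

namespace CrossedProduct

universe u v w

variable {A : Type u} [CStarAlgebra A] {G : Type v} [Group G] (α : G →* (A ≃⋆ₐ[ℂ] A))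

/-- The representation of `A` on `ℓ²(G, H)` by `(a ξ) n = π (α n⁻¹ a) (ξ n)`. -/
def inducedRep {H : Type w} [NormedAddCommGroup H] [InnerProductSpace ℂ H] [CompleteSpace H]
    (π : A →⋆ₐ[ℂ] (H →L[ℂ] H)) :
    A →⋆ₐ[ℂ] (lp (fun _ : G => H) 2 →L[ℂ] lp (fun _ : G => H) 2) :=
  directSumRep fun n => π.comp (α n⁻¹ : A →⋆ₐ[ℂ] A)

@[simp]
theorem inducedRep_apply {H : Type w} [NormedAddCommGroup H] [InnerProductSpace ℂ H]
    [CompleteSpace H] (π : A →⋆ₐ[ℂ] (H →L[ℂ] H)) (a : A) (x : lp (fun _ : G => H) 2) (n : G) :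
    inducedRep α π a x n = π (α n⁻¹ a) (x n) :=
  rfl

theorem translationRep_mul_inducedRep {H : Type w} [NormedAddCommGroup H]
    [InnerProductSpace ℂ H] [CompleteSpace H] (π : A →⋆ₐ[ℂ] (H →L[ℂ] H)) (g : G) (a : A) :
    (translationRep G H g : lp (fun _ : G => H) 2 →L[ℂ] lp (fun _ : G => H) 2) *
      inducedRep α π a * star (translationRep G H g :
        lp (fun _ : G => H) 2 →L[ℂ] lp (fun _ : G => H) 2) = inducedRep α π (α g a) := by
  rw [← Unitary.coe_star, Unitary.star_eq_inv, ← map_inv]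
  ext x n
  simp only [mul_apply_eq_comp, translationRep_apply, inducedRep_apply]
  rw [inv_inv, mul_inv_cancel_left, mul_inv_rev, inv_inv, map_mul]
  rfl

instance {H : Type w} [NormedAddCommGroup H] [Nontrivial H] :
    Nontrivial (lp (fun _ : G => H) 2) := by
  classical
  obtain ⟨x, hx⟩ := exists_ne (0 : H)
  refine ⟨lp.single 2 1 x, 0, fun h => hx ?_⟩
  simpa using congrArg (fun y : lp (fun _ : G => H) 2 => y 1) h

/-- The regular covariant representation induced by a representation of `A`. -/
abbrev regularRep {H : Type (max u v)} [NormedAddCommGroup H] [InnerProductSpace ℂ H]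
    [CompleteSpace H] [Nontrivial H] (π : A →⋆ₐ[ℂ] (H →L[ℂ] H)) : CovariantRep α where
  H := lp (fun _ : G => H) 2
  π := inducedRep α π
  U := translationRep G H
  covariant := translationRep_mul_inducedRep α π

theorem nonempty_covariantRep [PartialOrder A] [StarOrderedRing A] [Nontrivial A] :
    Nonempty (CovariantRep α) := by
  obtain ⟨f, hf⟩ := exists_nontrivial_GNS (A := A)
  -- The GNS space lives in the universe of A, so `regularRep` does not apply directly; passing to
  -- ℓ² over G raises it to the required universe.
  exact ⟨{  H := lp (fun _ : G => f.GNS) 2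
            π := inducedRep α f.gnsStarAlgHom
            U := translationRep G f.GNS
            covariant := translationRep_mul_inducedRep α _ }⟩

/-- The universal representation of `A`, as a homomorphism. -/
def ofAlgebraHom : A →⋆ₐ[ℂ] Ambient α where
  toFun := ofAlgebra α
  map_one' := by ext ρ : 2; exact map_one ρ.π
  map_mul' a b := by ext ρ : 2; exact map_mul ρ.π a b
  map_zero' := by ext ρ : 2; exact map_zero ρ.π
  map_add' a b := by ext ρ : 2; exact map_add ρ.π a b
  commutes' c := by ext ρ : 2; exact AlgHomClass.commutes ρ.π c
  map_star' a := by ext ρ : 2; exact map_star ρ.π a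

/-- The universal unitary representation of `G`, as a homomorphism. -/
def ofGroupHom : G →* Ambient α where
  toFun := ofGroup α
  map_one' := by ext ρ : 2; exact congrArg Subtype.val (map_one ρ.U)
  map_mul' g h := by ext ρ : 2; exact congrArg Subtype.val (map_mul ρ.U g h)

theorem star_ofGroupHom (g : G) : star (ofGroupHom α g) = ofGroupHom α g⁻¹ := by
  ext ρ : 2
  exact congrArg Subtype.val (map_inv ρ.U g).symm

@[simp]
theorem ofGroupHom_inv_mul (g : G) : ofGroupHom α g⁻¹ * ofGroupHom α g = 1 := by
  rw [← map_mul, inv_mul_cancel, map_one]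

theorem ofGroupHom_mul_ofAlgebraHom (g : G) (a : A) :
    ofGroupHom α g * ofAlgebraHom α a = ofAlgebraHom α (α g a) * ofGroupHom α g := by
  have h : ofGroupHom α g * ofAlgebraHom α a * star (ofGroupHom α g) =
      ofAlgebraHom α (α g a) := by
    ext ρ : 2
    exact ρ.covariant g a
  rw [← h, star_ofGroupHom, mul_assoc _ (ofGroupHom α g⁻¹), ofGroupHom_inv_mul, mul_one]

theorem norm_ofGroupHom_le (g : G) : ‖ofGroupHom α g‖ ≤ 1 :=
  lp.norm_le_of_forall_le zero_le_one fun ρ => (CStarRing.norm_of_mem_unitary (ρ.U g).2).le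

/-! ### The canonical expectation and its averages. -/

section Expectation

variable [DecidableEq G]

theorem norm_compression_le (x : Ambient α) (ρ : CovariantRep α) :
    ‖lp.evalCLM ℂ (fun _ : G => ρ.H) 2 1 ∘L x (regularRep α ρ.π) ∘L
      lp.singleContinuousLinearMap ℂ (fun _ : G => ρ.H) 2 1‖ ≤ ‖x‖ := by
  have h1 := norm_evalCLM_le (H := ρ.H) (1 : G)
  have h2 := norm_singleContinuousLinearMap_le (H := ρ.H) (1 : G)
  have h3 := lp.norm_apply_le_norm ENNReal.top_ne_zero x (regularRep α ρ.π)
  calc _ ≤ 1 * (‖x‖ * 1) := by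
        refine (ContinuousLinearMap.opNorm_comp_le _ _).trans ?_
        refine mul_le_mul h1 ?_ (norm_nonneg _) zero_le_one
        refine (ContinuousLinearMap.opNorm_comp_le _ _).trans ?_
        exact mul_le_mul h3 h2 (norm_nonneg _) (norm_nonneg _)
    _ = ‖x‖ := by ring

/-- Compression of the regular representations to the coordinate of `1`. On the crossed product
this is the canonical conditional expectation onto `A`. -/
def expectation : Ambient α →L[ℂ] Ambient α :=
  LinearMap.mkContinuous
    { toFun := fun x => ⟨fun ρ => lp.evalCLM ℂ (fun _ : G => ρ.H) 2 1 ∘L x (regularRep α ρ.π) ∘L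
        lp.singleContinuousLinearMap ℂ (fun _ : G => ρ.H) 2 1,
        memℓp_infty ⟨‖x‖, by rintro _ ⟨ρ, rfl⟩; exact norm_compression_le α x ρ⟩⟩
      map_add' := fun x y => by
        ext ρ ξ
        rfl
      map_smul' := fun c x => by
        ext ρ ξ
        rfl } 1 fun x => by
    rw [one_mul]
    exact lp.norm_le_of_forall_le (norm_nonneg _) (norm_compression_le α x)

theorem norm_expectation_le (x : Ambient α) : ‖expectation α x‖ ≤ ‖x‖ :=
  lp.norm_le_of_forall_le (norm_nonneg _) (norm_compression_le α x)

theorem expectation_apply_apply (x : Ambient α) (ρ : CovariantRep α) (ξ : ρ.H) :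
    expectation α x ρ ξ =
      (x (regularRep α ρ.π) (lp.single 2 (1 : G) ξ) : lp (fun _ : G => ρ.H) 2) 1 :=
  rfl

theorem inducedRep_single {H : Type w} [NormedAddCommGroup H] [InnerProductSpace ℂ H]
    [CompleteSpace H] (π : A →⋆ₐ[ℂ] (H →L[ℂ] H)) (a : A) (n : G) (ξ : H) :
    inducedRep α π a (lp.single 2 n ξ) = lp.single 2 n (π (α n⁻¹ a) ξ) := by
  ext m
  rw [inducedRep_apply]
  rcases eq_or_ne m n with rfl | h
  · simp
  · simp [h]

theorem translationRep_single {H : Type w} [NormedAddCommGroup H] [InnerProductSpace ℂ H]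
    [CompleteSpace H] (g n : G) (ξ : H) :
    (translationRep G H g : lp (fun _ : G => H) 2 →L[ℂ] lp (fun _ : G => H) 2)
      (lp.single 2 n ξ) = lp.single 2 (g * n) ξ := by
  ext m
  rw [translationRep_apply, lp.single_apply, lp.single_apply]
  simp only [Pi.single_apply, inv_mul_eq_iff_eq_mul]

theorem expectation_mul_mul (a b : A) (x : Ambient α) :
    expectation α (ofAlgebraHom α a * x * ofAlgebraHom α b) =
      ofAlgebraHom α a * expectation α x * ofAlgebraHom α b := by
  ext ρ ξ
  rw [expectation_apply_apply]
  change inducedRep α ρ.π a (x (regularRep α ρ.π) (inducedRep α ρ.π b (lp.single 2 1 ξ))) 1 =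
    ρ.π a ((x (regularRep α ρ.π) (lp.single 2 (1 : G) (ρ.π b ξ)) : lp (fun _ : G => ρ.H) 2) 1)
  rw [inducedRep_single, inducedRep_apply]
  simp

theorem expectation_monomial (a : A) (g : G) :
    expectation α (ofAlgebraHom α a * ofGroupHom α g) =
      if g = 1 then ofAlgebraHom α a else 0 := by
  ext ρ ξ
  rw [expectation_apply_apply]
  change inducedRep α ρ.π a ((translationRep G ρ.H g :
    lp (fun _ : G => ρ.H) 2 →L[ℂ] lp (fun _ : G => ρ.H) 2) (lp.single 2 1 ξ)) 1 = _
  rw [translationRep_single, inducedRep_single, mul_one]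
  split_ifs with h
  · subst h
    simp
    rfl
  · rw [lp.single_apply_ne _ _ _ (Ne.symm h)]
    rfl

/-- Translations turn the compression of u_m⁻¹ x u_n at the coordinate 1 into the (m, n) matrix
entry of x in the regular representation induced by ρ.π. The outer unitaries are those of ρ itself,
so `norm_sum_sum_compression_le` applies. -/
theorem norm_average_le (K : Finset G) (x : Ambient α) :
    ‖((K.card : ℂ)⁻¹) • ∑ m ∈ K, ∑ n ∈ K, ofGroupHom α m *
      expectation α (ofGroupHom α m⁻¹ * x * ofGroupHom α n) * ofGroupHom α n⁻¹‖ ≤ ‖x‖ := by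
  refine lp.norm_le_of_forall_le (norm_nonneg _) fun ρ => ?_
  have h : (((K.card : ℂ)⁻¹) • ∑ m ∈ K, ∑ n ∈ K, ofGroupHom α m *
      expectation α (ofGroupHom α m⁻¹ * x * ofGroupHom α n) * ofGroupHom α n⁻¹) ρ =
      ((K.card : ℂ)⁻¹) • ∑ m ∈ K, ∑ n ∈ K,
      (ρ.U m : ρ.H →L[ℂ] ρ.H) ∘L (lp.evalCLM ℂ (fun _ : G => ρ.H) 2 m ∘L x (regularRep α ρ.π) ∘L
      lp.singleContinuousLinearMap ℂ (fun _ : G => ρ.H) 2 n) ∘L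
        star (ρ.U n : ρ.H →L[ℂ] ρ.H) := by
    rw [lp.coeFn_smul, Pi.smul_apply, lp.coeFn_sum, Finset.sum_apply]
    congr 1
    refine Finset.sum_congr rfl fun m _ => ?_
    rw [lp.coeFn_sum, Finset.sum_apply]
    refine Finset.sum_congr rfl fun n _ => ?_
    rw [← star_ofGroupHom α n]
    ext ξ
    change (ρ.U m : ρ.H →L[ℂ] ρ.H) ((expectation α (ofGroupHom α m⁻¹ * x * ofGroupHom α n)) ρ
      (star (ρ.U n : ρ.H →L[ℂ] ρ.H) ξ)) = _
    rw [expectation_apply_apply]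
    change (ρ.U m : ρ.H →L[ℂ] ρ.H) ((translationRep G ρ.H m⁻¹ : lp (fun _ : G => ρ.H) 2 →L[ℂ]
      lp (fun _ : G => ρ.H) 2) (x (regularRep α ρ.π) ((translationRep G ρ.H n :
      lp (fun _ : G => ρ.H) 2 →L[ℂ] lp (fun _ : G => ρ.H) 2)
      (lp.single 2 1 (star (ρ.U n : ρ.H →L[ℂ] ρ.H) ξ)))) 1) = _
    rw [translationRep_single, translationRep_apply, inv_inv, mul_one, mul_one]
    rfl
  rw [h, norm_smul, norm_inv, Complex.norm_natCast]
  have hle := norm_sum_sum_compression_le (fun n => ρ.U n) K (x (regularRep α ρ.π))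
  have hx := lp.norm_apply_le_norm ENNReal.top_ne_zero x (regularRep α ρ.π)
  refine inv_mul_le_of_le_mul₀ (Nat.cast_nonneg _) (norm_nonneg _) (hle.trans ?_)
  gcongr

/-- The canonical conditional expectation on the full crossed product. -/
def covariantExpectation : CovariantExpectation α (Ambient α) where
  ι := ofAlgebraHom α
  u := ofGroupHom α
  Φ := expectation α
  star_u := star_ofGroupHom α
  norm_u_le := norm_ofGroupHom_le α
  covariant := ofGroupHom_mul_ofAlgebraHom α
  norm_Φ_le := norm_expectation_le α
  Φ_mul_mul := expectation_mul_mul α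
  Φ_monomial := expectation_monomial α
  norm_average_le := norm_average_le α

end Expectation

theorem nontrivial_ambient [Nonempty (CovariantRep α)] : Nontrivial (Ambient α) := by
  obtain ⟨ρ⟩ := ‹Nonempty (CovariantRep α)›
  refine ⟨1, 0, fun h => one_ne_zero (α := ρ.H →L[ℂ] ρ.H) ?_⟩
  exact congrArg (fun x : Ambient α => x ρ) h

/-- The full crossed product of a simple algebra is simple if the group has a Følner net and the
algebra has positive elements of norm one which are approximately central and approximately
orthogonal to their translates. -/
theorem isSimple_full_of_forall_exists [DecidableEq G] [PartialOrder A] [StarOrderedRing A]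
    (hA : IsSimpleCStarAlgebra A)
    {κ : Type*} {k : Filter κ} [k.NeBot] {K : κ → Finset G}
    (hK : ∀ g, Tendsto (fun i => (({n ∈ K i | g * n ∈ K i}).card : ℂ) / (K i).card) k (𝓝 1))
    (h : ∀ (F : Finset A) (S : Finset G) (ε : ℝ), 0 < ε → ∃ e : A, 0 ≤ e ∧ ‖e‖ = 1 ∧
      (∀ y ∈ F, ‖e * y - y * e‖ < ε) ∧ ∀ g ∈ S, g ≠ 1 → ‖e * α g e‖ < ε) :
    IsSimpleCStarAlgebra (full α) := by
  classical
  have := hA.1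
  have := nonempty_covariantRep α
  have := nontrivial_ambient α
  -- The net is indexed by a finite set to commute with, a finite set of translates, and n giving
  -- tolerance 1/(n+1).
  choose e he hnorm hcomm horth using
    fun i : Finset A × Finset G × ℕ => h i.1 i.2.1 (1 / (i.2.2 + 1)) Nat.one_div_pos_of_nat
  have hlim : Tendsto (fun i : Finset A × Finset G × ℕ => 1 / ((i.2.2 : ℝ) + 1)) atTop (𝓝 0) := by
    refine tendsto_one_div_add_atTop_nhds_zero_nat.comp ?_
    simp only [← prod_atTop_atTop_eq]
    exact tendsto_snd.comp tendsto_snd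
  refine (covariantExpectation α).isSimple_generated hA hK (l := atTop) he hnorm
    (fun y => ?_) fun g hg => ?_
  · refine squeeze_zero_norm' ?_ hlim
    filter_upwards [eventually_ge_atTop (({y}, ∅, 0) : Finset A × Finset G × ℕ)] with i hi
    exact (hcomm i y (hi.1 (Finset.mem_singleton_self y))).le
  · refine squeeze_zero_norm' ?_ hlim
    filter_upwards [eventually_ge_atTop ((∅, {g}, 0) : Finset A × Finset G × ℕ)] with i hi
    exact (horth i g (hi.2.1 (Finset.mem_singleton_self g)) hg).le

end CrossedProduct
end

noncomputable section

open Filter Topology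

/-! ### Følner sets in ℤ and elements from Rokhlin towers. -/

section Folner

/-- Intervals form a Følner sequence in the integers. -/
theorem tendsto_card_filter_Ico_div (g : Multiplicative ℤ) :
    Tendsto (fun N : ℕ => (({n ∈ (Finset.Ico (0 : ℤ) N).map Multiplicative.ofAdd.toEmbedding |
      g * n ∈ (Finset.Ico (0 : ℤ) N).map Multiplicative.ofAdd.toEmbedding}).card : ℂ) /
      ((Finset.Ico (0 : ℤ) N).map Multiplicative.ofAdd.toEmbedding).card) atTop (𝓝 1) := by
  have hset (N : ℕ) : {n ∈ (Finset.Ico (0 : ℤ) N).map Multiplicative.ofAdd.toEmbedding |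
      g * n ∈ (Finset.Ico (0 : ℤ) N).map Multiplicative.ofAdd.toEmbedding} =
      (Finset.Ico (max 0 (-g.toAdd)) (min (N : ℤ) (N - g.toAdd))).map
        Multiplicative.ofAdd.toEmbedding := by
    ext n
    simp only [Finset.mem_filter, Finset.mem_map_equiv, Finset.mem_Ico]
    change (0 ≤ n.toAdd ∧ n.toAdd < N) ∧ (0 ≤ g.toAdd + n.toAdd ∧ g.toAdd + n.toAdd < N) ↔
      max 0 (-g.toAdd) ≤ n.toAdd ∧ n.toAdd < min (N : ℤ) (N - g.toAdd)
    omega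
  have hlim : Tendsto (fun N : ℕ => 1 - (g.toAdd.natAbs : ℂ) / N) atTop (𝓝 1) := by
    simpa using (tendsto_const_div_atTop_nhds_zero_nat (g.toAdd.natAbs : ℂ)).const_sub 1
  refine hlim.congr' ?_
  filter_upwards [eventually_ge_atTop g.toAdd.natAbs, eventually_gt_atTop 0] with N hN hN0
  rw [hset, Finset.card_map, Finset.card_map, Int.card_Ico, Int.card_Ico]
  have h1 : (min (N : ℤ) (N - g.toAdd) - max 0 (-g.toAdd)).toNat = N - g.toAdd.natAbs := by omega
  have h2 : ((N : ℂ)) ≠ 0 := Nat.cast_ne_zero.2 hN0.ne'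
  rw [h1, sub_zero, Int.toNat_natCast, Nat.cast_sub hN, sub_div, div_self h2]

end Folner

variable {A : Type*} [CStarAlgebra A] [PartialOrder A] [StarOrderedRing A]

/-- The element e_1 of the tower works: α_g(e_1) ≈ e_g, which is orthogonal to e_1 for g ≠ 1. -/
theorem FiniteGroupGTRP.exists_approx_orthogonal [Nontrivial A] {G : Type*} [Group G] [Fintype G]
    {α : G →* (A ≃⋆ₐ[ℂ] A)} (h : FiniteGroupGTRP α) (F : Finset A) {ε : ℝ} (hε : 0 < ε) :
    ∃ e : A, 0 ≤ e ∧ ‖e‖ = 1 ∧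
      (∀ y ∈ F, ‖e * y - y * e‖ < ε) ∧ ∀ g : G, g ≠ 1 → ‖e * α g e‖ < ε := by
  obtain ⟨e, he, horth, -, hcomm, hα⟩ := h ε hε F 1 zero_le_one one_ne_zero
  refine ⟨e 1, (he 1).1, (he 1).2, hcomm 1, fun g hg => ?_⟩
  have h1 : e 1 * α g (e 1) = e 1 * (α g (e 1) - e (g * 1)) := by
    rw [mul_sub, horth 1 (g * 1) (by simpa using hg.symm), sub_zero]
  rw [h1]
  calc _ ≤ ‖e 1‖ * ‖α g (e 1) - e (g * 1)‖ := norm_mul_le _ _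
    _ < ε := by rw [(he 1).2, one_mul]; exact hα g 1

theorem AutomorphismGTRP.exists_approx_orthogonal [Nontrivial A] {α : A ≃⋆ₐ[ℂ] A}
    (h : AutomorphismGTRP α) (F : Finset A) (N : ℕ) {ε : ℝ} (hε : 0 < ε) :
    ∃ e : A, 0 ≤ e ∧ ‖e‖ = 1 ∧ (∀ y ∈ F, ‖e * y - y * e‖ < ε) ∧
      ∀ n : ℤ, n ≠ 0 → n.natAbs ≤ N → ‖e * (α ^ n) e‖ < ε := by
  have hN : (0 : ℝ) < N + 1 := by positivity
  -- Height N + 1 leaves room for N shifts of the bottom element; n ≤ N shifts accumulate an error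
  -- of at most n ε / (N + 1) < ε.
  obtain ⟨e, he, horth, -, hcomm, hα⟩ := h F (ε / (N + 1)) (by positivity) (N + 1) (by omega) 1
    zero_le_one one_ne_zero
  have hle : ε / (N + 1) ≤ ε := div_le_self hε.le (by linarith [(Nat.cast_nonneg N : (0 : ℝ) ≤ N)])
  have hpow (n : ℕ) (hn : n < N + 1) :
      ‖(α ^ n) (e 0) - e ⟨n, hn⟩‖ ≤ n * (ε / (N + 1)) := by
    induction n with
    | zero => simp
    | succ n ih =>
      have h1 := ih (by omega)
      have h2 := hα ⟨n, by omega⟩ ⟨n + 1, hn⟩ rfl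
      rw [pow_succ', StarAlgEquiv.mul_apply]
      rw [← StarAlgEquiv.norm_map α, map_sub] at h1
      have h3 := norm_sub_le_norm_sub_add_norm_sub (α ((α ^ n) (e 0))) (α (e ⟨n, by omega⟩))
        (e ⟨n + 1, hn⟩)
      push_cast
      linarith
  have hpos (n : ℕ) (hn0 : n ≠ 0) (hn : n < N + 1) : ‖e 0 * (α ^ n) (e 0)‖ < ε := by
    have h1 : e 0 * (α ^ n) (e 0) = e 0 * ((α ^ n) (e 0) - e ⟨n, hn⟩) := by
      rw [mul_sub, horth 0 ⟨n, hn⟩ (by rw [Ne, Fin.ext_iff]; exact hn0.symm), sub_zero]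
    rw [h1]
    calc _ ≤ ‖e 0‖ * ‖(α ^ n) (e 0) - e ⟨n, hn⟩‖ := norm_mul_le _ _
      _ ≤ n * (ε / (N + 1)) := by rw [(he 0).2, one_mul]; exact hpow n hn
      _ < (N + 1) * (ε / (N + 1)) := by
        gcongr
        exact_mod_cast hn
      _ = ε := mul_div_cancel₀ _ hN.ne'
  refine ⟨e 0, (he 0).1, (he 0).2, fun y hy => (hcomm 0 y hy).trans_le hle, fun n hn0 hn => ?_⟩
  obtain ⟨m, rfl | rfl⟩ := n.eq_nat_or_neg
  · rw [zpow_natCast]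
    exact hpos m (by omega) (by omega)
  · have hsa (i) : star (e i) = e i := (IsSelfAdjoint.of_nonneg (he i).1).star_eq
    -- Negative powers reduce to positive ones: applying the isometry α^m to e α^(−m)(e) gives
    -- α^m(e) e, the adjoint of e α^m(e).
    have h1 : (α ^ m) (e 0 * (α ^ (-(m : ℤ))) (e 0)) = star (e 0 * (α ^ m) (e 0)) := by
      rw [map_mul, ← StarAlgEquiv.mul_apply, ← zpow_natCast, ← zpow_add, add_neg_cancel, zpow_zero,
        star_mul, ← map_star, hsa]
      rfl
    rw [← StarAlgEquiv.norm_map (α ^ m), h1, norm_star]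
    exact hpos m (by omega) (by omega)

end

theorem corollary5p4 {A : Type*} [CStarAlgebra A] [PartialOrder A] [StarOrderedRing A]
    (hA : IsSimpleCStarAlgebra A) :
    (∀ (G : Type*) [Group G] [Fintype G] (α : G →* (A ≃⋆ₐ[ℂ] A)),
      FiniteGroupGTRP α → IsSimpleCStarAlgebra (CrossedProduct.full α)) ∧
    (∀ α : A ≃⋆ₐ[ℂ] A, AutomorphismGTRP α →
      IsSimpleCStarAlgebra (CrossedProduct.full (zpowersHom (A ≃⋆ₐ[ℂ] A) α))) := by
  have := hA.1
  refine ⟨fun G _ _ α h => ?_, fun α h => ?_⟩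
  · classical
    refine CrossedProduct.isSimple_full_of_forall_exists α hA (k := (Filter.atTop : Filter ℕ))
      (K := fun _ => Finset.univ) (fun g => ?_) fun F S ε hε => ?_
    · simp
    · obtain ⟨e, he, hnorm, hcomm, horth⟩ := h.exists_approx_orthogonal F hε
      exact ⟨e, he, hnorm, hcomm, fun g _ => horth g⟩
  · refine CrossedProduct.isSimple_full_of_forall_exists _ hA tendsto_card_filter_Ico_div
      fun F S ε hε => ?_
    obtain ⟨e, he, hnorm, hcomm, horth⟩ :=
      -- The tower is taken high enough to reach every exponent occurring in S.
      h.exists_approx_orthogonal F (S.sup fun g => g.toAdd.natAbs) hε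
    refine ⟨e, he, hnorm, hcomm, fun g hg hg1 => ?_⟩
    rw [zpowersHom_apply]
    exact horth g.toAdd (by simpa using hg1)
      (Finset.le_sup (f := fun g : Multiplicative ℤ => g.toAdd.natAbs) hg)
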